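/- Let $\mathbb{N}=\{1,2,3,\dots\}$ be discrete and give $\mathbb{N}^{\mathbb{N}\times\mathbb{N}}$ the product topology. Let $\mathcal{G}\subseteq\mathbb{N}^{\mathbb{N}\times\mathbb{N}}$ be the subspace of those tables $G$ that are the multiplication table of a group $\widetilde G$ with underlying set $\mathbb{N}$ and identity element $1$, and let $\mathcal{A}=\{G\in\mathcal{G}:\widetilde G\text{ is abelian}\}$ with the subspace topology. For a prime $p$ let $\mathbb{Z}[p^\infty]$ be the Prüfer $p$-group, that is, the subgroup of $\mathbb{Q}/\mathbb{Z}$ of elements of $p$-power order, and let $P=\bigoplus_{p\text{ prime}}\mathbb{Z}[p^\infty]^{(\mathbb{N})}$, where $B^{(\mathbb{N})}$ is the direct sum of countably infinitely many copies of $B$. Let $\mathcal{I}=\{G\in\mathcal{A}:\widetilde G\cong P\}$. Then: 1. $\mathcal{A}$ is a Polish space; 2. $\mathcal{I}$ is the set of all $G\in\mathcal{A}$ such that $\widetilde G$ is a divisible torsion group into which every finite abelian group embeds; 3. $\mathcal{I}$ is a $G_\delta$ subset of $\mathcal{A}$; 4. $\mathcal{I}$ is dense in $\mathcal{A}$; 5.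 $\mathcal{I}$ is comeager in $\mathcal{A}$. In particular there is a generic countably infinite abelian group: there is $A\in\mathcal{A}$ with $\widetilde A\cong P$ whose isomorphism class $\{G\in\mathcal{A}:\widetilde G\cong\widetilde A\}$ is comeager in $\mathcal{A}$. -/

import Mathlib

open scoped DirectSum

/-- The tables `A ∈ ℕ^(ℕ × ℕ)`, with `ℕ = {1, 2, 3, …}`, that are the multiplication table of a
group with underlying set `ℕ` and identity element `1`. -/
def groupTables : Set (ℕ+ × ℕ+ → ℕ+) :=
  {A | (∀ a b c, A (A (a, b), c) = A (a, A (b, c))) ∧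
       (∀ a, A (1, a) = a ∧ A (a, 1) = a) ∧
       (∀ a, ∃ b, A (b, a) = 1 ∧ A (a, b) = 1)}

/-- The space of multiplication tables of groups on `ℕ`, a subspace of the countable power
`ℕ^(ℕ × ℕ)` of the discrete space `ℕ`. -/
abbrev GroupTable : Type := ↥groupTables

/-- The group with underlying set `ℕ` whose multiplication table is `G`. (A type synonym of `ℕ+`,
so that the usual multiplication of `ℕ+` does not interfere.) -/
def GroupTable.Carrier (_G : GroupTable) : Type := ℕ+

noncomputable instance GroupTable.instGroupCarrier (G : GroupTable) : Group G.Carrier where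
  mul a b := G.1 (a, b)
  one := (1 : ℕ+)
  inv a := Classical.choose (G.2.2.2 a)
  mul_assoc a b c := G.2.1 a b c
  one_mul a := (G.2.2.1 a).1
  mul_one a := (G.2.2.1 a).2
  inv_mul_cancel a := (Classical.choose_spec (G.2.2.2 a)).1

/-- The set of tables of abelian groups. -/
def abelianTables : Set GroupTable :=
  {G | ∀ a b : G.Carrier, a * b = b * a}

/-- The space of multiplication tables of abelian groups on `ℕ`, with the subspace topology. -/
abbrev AbelianTable : Type := ↥abelianTables

/-- The group with underlying set `ℕ` whose multiplication table is `G`. -/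
abbrev AbelianTable.Carrier (G : AbelianTable) : Type := G.1.Carrier

/-- The isomorphism class of the group `H` in the space of abelian group tables. -/
def isoClass (H : Type*) [Group H] : Set AbelianTable :=
  {G | Nonempty (G.Carrier ≃* H)}

/-- The Prüfer group `ℤ[p^∞]`: the elements of `ℚ / ℤ` whose order is a power of `p`. -/
abbrev PruferGroup (p : Nat.Primes) : Type :=
  ↥(AddCommGroup.primaryComponent (AddCircle (1 : ℚ)) (p : ℕ))

/-- The direct sum, over all primes `p`, of countably infinitely many copies of `ℤ[p^∞]`. -/
abbrev PruferSum : Type := ⨁ (p : Nat.Primes) (_ : ℕ+), PruferGroup p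

/-- The tables of divisible groups. -/
def divisibleTables : Set AbelianTable :=
  {G | ∀ (g : G.Carrier) (k : ℕ), 0 < k → ∃ m : G.Carrier, m ^ k = g}

/-- The tables of torsion groups. -/
def torsionTables : Set AbelianTable :=
  {G | IsMulTorsion G.Carrier}

/-- The tables of groups into which every finite abelian group can be embedded. -/
def finiteUniversalTables : Set AbelianTable :=
  {G | ∀ (H : Type) [CommGroup H] [Finite H], ∃ f : H →* G.Carrier, Function.Injective f}

/-!
A divisible group is an injective `ℤ`-module, so isomorphisms between the `p`-socles
`{x | p • x = 0}` of two divisible groups, one for each prime `p`, extend to a homomorphism; for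
torsion groups it is bijective because it is so on socles. A socle is an `𝔽_p`-vector space, hence a
countable divisible torsion group with infinite socles is unique up to isomorphism. Both the sum of
Prüfer groups and a countable sum of copies of `ℚ / ℤ` are such groups.

These properties are countable intersections of open conditions on a table. For density, finitely
many entries of the table of an abelian group involve a finite set of elements; enough characters
give a homomorphism into a countable sum of copies of `ℚ / ℤ` that is injective on this set.
Extending its restriction to a bijection from `ℕ` and pulling back the group structure yields a
table with the same entries. The existence of inverses is likewise a countable intersection of open
conditions, so the group tables form a Gδ set, in which the abelian ones are closed.
-/

section Divisible

variable {D : Type*} [AddCommGroup D]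

/-- Divisibility of an additive group, as a proposition (Mathlib's `DivisibleBy` carries a choice
of quotients). -/
def IsDivisibleAddGroup (D : Type*) [AddCommGroup D] : Prop :=
  ∀ n : ℕ, n ≠ 0 → Function.Surjective fun x : D => n • x

theorem IsDivisibleAddGroup.baer (hD : IsDivisibleAddGroup D) : Module.Baer ℤ D :=
  let _ : DivisibleBy D ℕ := divisibleByOfSMulRightSurj D ℕ fun {n} => hD n
  let _ : DivisibleBy D ℤ := AddGroup.divisibleByIntOfDivisibleByNat D
  Module.Baer.of_divisible D

theorem isDivisibleAddGroup_of_divisibleBy [DivisibleBy D ℤ] : IsDivisibleAddGroup D :=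
  fun n hn x => ⟨DivisibleBy.div x (n : ℤ), by
    simpa only [natCast_zsmul] using DivisibleBy.div_cancel x (Nat.cast_ne_zero.2 hn : (n : ℤ) ≠ 0)⟩

theorem IsDivisibleAddGroup.directSum {ι : Type*} {M : ι → Type*} [∀ i, AddCommGroup (M i)]
    (h : ∀ i, IsDivisibleAddGroup (M i)) : IsDivisibleAddGroup (⨁ i, M i) := by
  classical
  intro n hn x
  induction x using DirectSum.induction_on with
  | zero => exact ⟨0, smul_zero n⟩
  | of i x =>
    obtain ⟨y, rfl⟩ := h i n hn x
    exact ⟨DirectSum.of M i y, (map_nsmul _ n y).symm⟩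
  | add x y hx hy =>
    obtain ⟨a, rfl⟩ := hx
    obtain ⟨b, rfl⟩ := hy
    exact ⟨a + b, smul_add n a b⟩

theorem IsDivisibleAddGroup.primaryComponent (hD : IsDivisibleAddGroup D) {p : ℕ}
    (hp : p.Prime) : IsDivisibleAddGroup (AddCommGroup.primaryComponent D p) := by
  intro n hn
  induction n using Nat.recOnMul with
  | zero => exact absurd rfl hn
  | one => exact fun x => ⟨x, one_nsmul x⟩
  | mul a b ha hb =>
    have hcomp := (ha (left_ne_zero_of_mul hn)).comp (hb (right_ne_zero_of_mul hn))
    simpa only [Function.comp_def, ← mul_nsmul'] using hcomp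
  | prime q hq =>
    rintro ⟨x, k, hk⟩
    obtain rfl | hqp := eq_or_ne q p
    · obtain ⟨y, rfl⟩ := hD q hn x
      exact ⟨⟨y, k + 1, by rw [pow_succ, mul_nsmul', hk]⟩, rfl⟩
    · have hcop : q.Coprime (addOrderOf x) :=
        (((Nat.coprime_primes hq hp).2 hqp).pow_right k).coprime_dvd_right
          (addOrderOf_dvd_iff_nsmul_eq_zero.2 hk)
      obtain ⟨m, hm⟩ := exists_nsmul_eq_self_of_coprime hcop
      exact ⟨m • ⟨x, k, hk⟩, Subtype.ext ((smul_comm q m x).trans hm)⟩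

end Divisible

section Torsion

theorem isAddTorsion_directSum {ι : Type*} {M : ι → Type*} [∀ i, AddCommMonoid (M i)]
    (h : ∀ i, IsAddTorsion (M i)) : IsAddTorsion (⨁ i, M i) := by
  classical
  intro x
  induction x using DirectSum.induction_on with
  | zero => exact IsOfFinAddOrder.zero
  | of i x => exact AddMonoidHom.isOfFinAddOrder _ (h i x)
  | add x y hx hy => exact hx.add hy

variable {D E : Type*} [AddCommGroup D] [AddCommGroup E] {f : D →+ E}

theorem injective_of_injective_on_socles (hD : IsAddTorsion D)
    (hf : ∀ p : ℕ, p.Prime → ∀ x : D, p • x = 0 → f x = 0 → x = 0) : Function.Injective f := by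
  refine (injective_iff_map_eq_zero f).2 fun x hx => ?_
  by_contra hne
  obtain ⟨p, hp, hpx⟩ := Nat.exists_prime_and_dvd (mt AddMonoid.addOrderOf_eq_one_iff.1 hne)
  have horder : addOrderOf ((addOrderOf x / p) • x) = p :=
    addOrderOf_nsmul_addOrderOf_sub (hD x).addOrderOf_pos.ne' hpx
  have hzero : (addOrderOf x / p) • x = 0 :=
    hf p hp _ (addOrderOf_dvd_iff_nsmul_eq_zero.1 horder.dvd) (by rw [map_nsmul, hx, smul_zero])
  rw [hzero, addOrderOf_zero] at horder
  exact hp.one_lt.ne horder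

theorem surjective_of_socles_subset_range (hD : IsDivisibleAddGroup D) (hE : IsAddTorsion E)
    (hf : ∀ p : ℕ, p.Prime → ∀ y : E, p • y = 0 → y ∈ f.range) : Function.Surjective f := by
  suffices ∀ n : ℕ, n ≠ 0 → ∀ y : E, n • y = 0 → y ∈ f.range from fun y =>
    this _ (hE y).addOrderOf_pos.ne' y (addOrderOf_nsmul_eq_zero y)
  intro n
  induction n using Nat.recOnMul with
  | zero => exact fun h => absurd rfl h
  | one => exact fun _ y hy => (one_nsmul y).symm.trans hy ▸ zero_mem _
  | prime p hp => exact fun _ => hf p hp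
  | mul a b ha hb =>
    intro hab y hy
    obtain ⟨x, hx⟩ := ha (left_ne_zero_of_mul hab) (b • y) (by rw [← mul_nsmul', hy])
    obtain ⟨z, rfl⟩ := hD b (right_ne_zero_of_mul hab) x
    obtain ⟨w, hw⟩ := hb (right_ne_zero_of_mul hab) (y - f z) (by
      rw [smul_sub, ← hx, map_nsmul, sub_self])
    exact ⟨w + z, by rw [map_add, hw, sub_add_cancel]⟩

theorem iSupIndep_torsionBy_primes :
    iSupIndep fun p : Nat.Primes => Submodule.torsionBy ℤ D ((p : ℕ) : ℤ) :=
  iSupIndep_iff_supIndep.2 fun _ => Submodule.supIndep_torsionBy fun p _ q _ hpq =>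
    Nat.isCoprime_iff_coprime.2
      ((Nat.coprime_primes p.2 q.2).2 fun h => hpq (Subtype.ext h))

theorem nonempty_addEquiv_of_torsionBy_addEquiv (hD : IsDivisibleAddGroup D)
    (hD' : IsAddTorsion D) (hE : IsDivisibleAddGroup E) (hE' : IsAddTorsion E)
    (φ : ∀ p : Nat.Primes,
      Submodule.torsionBy ℤ D ((p : ℕ) : ℤ) ≃+ Submodule.torsionBy ℤ E ((p : ℕ) : ℤ)) :
    Nonempty (D ≃+ E) := by
  classical
  let S (p : Nat.Primes) : Submodule ℤ D := Submodule.torsionBy ℤ D ((p : ℕ) : ℤ)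
  let incl : (⨁ p, S p) →+ D := DirectSum.toAddMonoid fun p => (S p).subtype.toAddMonoidHom
  have hincl : Function.Injective incl := iSupIndep_torsionBy_primes.dfinsupp_lsum_injective
  obtain ⟨F, hF⟩ := hE.baer.extension_property_addMonoidHom incl hincl
    (DirectSum.toAddMonoid fun p =>
      (Submodule.torsionBy ℤ E ((p : ℕ) : ℤ)).subtype.toAddMonoidHom.comp (φ p).toAddMonoidHom)
  have hFφ (p : Nat.Primes) (x : S p) : F x = φ p x := by
    simpa [incl] using DFunLike.congr_fun hF (DirectSum.of (fun p => S p) p x)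
  refine ⟨AddEquiv.ofBijective F
    ⟨injective_of_injective_on_socles hD' fun p hp x hx hFx => ?_,
      surjective_of_socles_subset_range hD hE' fun p hp y hy => ?_⟩⟩
  · have hx' : x ∈ S ⟨p, hp⟩ := (natCast_zsmul x p).trans hx
    have hφx : φ ⟨p, hp⟩ ⟨x, hx'⟩ = 0 := Subtype.ext ((hFφ ⟨p, hp⟩ ⟨x, hx'⟩).symm.trans hFx)
    exact congrArg Subtype.val ((map_eq_zero_iff _ (φ ⟨p, hp⟩).injective).1 hφx)
  · obtain ⟨x, hx⟩ := (φ ⟨p, hp⟩).surjective ⟨y, (natCast_zsmul y p).trans hy⟩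
    exact ⟨x, (hFφ _ x).trans (congrArg Subtype.val hx)⟩

end Torsion

section Socle

theorem infinite_basis_index {ι K V : Type*} [Semiring K] [Finite K] [AddCommMonoid V] [Module K V]
    [Infinite V] (b : Module.Basis ι K V) : Infinite ι := by
  by_contra hfin
  rw [not_infinite_iff_finite] at hfin
  have := Module.Finite.of_basis b
  exact (Module.finite_of_finite K (M := V)).not_infinite ‹_›

theorem nonempty_linearEquiv_of_countable_of_infinite (K : Type*) {V W : Type*} [Field K]
    [Finite K] [AddCommGroup V] [Module K V] [Countable V] [Infinite V] [AddCommGroup W]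
    [Module K W] [Countable W] [Infinite W] : Nonempty (V ≃ₗ[K] W) := by
  have := infinite_basis_index (Module.Basis.ofVectorSpace K V)
  have := infinite_basis_index (Module.Basis.ofVectorSpace K W)
  obtain ⟨e⟩ := nonempty_equiv_of_countable
    (α := Module.Basis.ofVectorSpaceIndex K V) (β := Module.Basis.ofVectorSpaceIndex K W)
  exact ⟨(Module.Basis.ofVectorSpace K V).equiv (Module.Basis.ofVectorSpace K W) e⟩

theorem nonempty_torsionBy_addEquiv {D E : Type*} [AddCommGroup D] [AddCommGroup E] [Countable D]
    [Countable E] {p : ℕ} (hp : p.Prime) (hD : {x : D | p • x = 0}.Infinite)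
    (hE : {x : E | p • x = 0}.Infinite) :
    Nonempty (Submodule.torsionBy ℤ D (p : ℤ) ≃+ Submodule.torsionBy ℤ E (p : ℤ)) := by
  have : Fact p.Prime := ⟨hp⟩
  let _ : Module (ZMod p) (Submodule.torsionBy ℤ D (p : ℤ)) := AddSubgroup.torsionBy.zmodModule
  let _ : Module (ZMod p) (Submodule.torsionBy ℤ E (p : ℤ)) := AddSubgroup.torsionBy.zmodModule
  have : Infinite (Submodule.torsionBy ℤ D (p : ℤ)) :=
    (hD.mono fun x hx => (natCast_zsmul x p).trans hx).to_subtype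
  have : Infinite (Submodule.torsionBy ℤ E (p : ℤ)) :=
    (hE.mono fun x hx => (natCast_zsmul x p).trans hx).to_subtype
  obtain ⟨e⟩ := nonempty_linearEquiv_of_countable_of_infinite (ZMod p)
    (V := Submodule.torsionBy ℤ D (p : ℤ)) (W := Submodule.torsionBy ℤ E (p : ℤ))
  exact ⟨e.toAddEquiv⟩

theorem infinite_socle_of_injective {D E : Type*} [AddMonoid D] [AddMonoid E] {p : ℕ}
    {f : D →+ E} (hf : Function.Injective f) (hD : {x : D | p • x = 0}.Infinite) :
    {y : E | p • y = 0}.Infinite :=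
  (hD.image hf.injOn).mono <| by
    rintro _ ⟨x, hx, rfl⟩
    exact (map_nsmul f p x).symm.trans ((congrArg f hx).trans (map_zero f))

theorem infinite_socle_directSum {ι M : Type*} [Infinite ι] [AddCommMonoid M] {p : ℕ} {x : M}
    (hx : x ≠ 0) (hpx : p • x = 0) : {y : ⨁ _ : ι, M | p • y = 0}.Infinite := by
  classical
  refine Set.infinite_of_injective_forall_mem (f := fun i : ι => DirectSum.of (fun _ => M) i x)
    (fun i j hij => ?_) fun i => ?_
  · by_contra hne
    have := DFunLike.congr_fun hij i
    rw [DirectSum.of_eq_same, DirectSum.of_eq_of_ne _ _ _ hne] at this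
    exact hx this
  · exact (map_nsmul _ p x).symm.trans (by rw [hpx, map_zero])

end Socle

section GenericGroup

/-- The algebraic content of genericity. Up to isomorphism the only countable group of this kind is
`PruferSum`; all three conditions become countable intersections of open conditions on a
multiplication table. -/
structure IsGenericAddGroup (D : Type*) [AddCommGroup D] : Prop where
  isDivisible : IsDivisibleAddGroup D
  isAddTorsion : IsAddTorsion D
  infinite_socle : ∀ p : ℕ, p.Prime → {x : D | p • x = 0}.Infinite

namespace IsGenericAddGroup

variable {D E : Type*} [AddCommGroup D] [AddCommGroup E]

theorem nonempty_addEquiv [Countable D] [Countable E] (hD : IsGenericAddGroup D)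
    (hE : IsGenericAddGroup E) : Nonempty (D ≃+ E) :=
  nonempty_addEquiv_of_torsionBy_addEquiv hD.isDivisible hD.isAddTorsion hE.isDivisible
    hE.isAddTorsion fun p =>
      (nonempty_torsionBy_addEquiv p.2 (hD.infinite_socle p p.2) (hE.infinite_socle p p.2)).some

theorem of_addEquiv (e : D ≃+ E) (hD : IsGenericAddGroup D) : IsGenericAddGroup E where
  isDivisible n hn y := by
    obtain ⟨x, hx⟩ := hD.isDivisible n hn (e.symm y)
    exact ⟨e x, (map_nsmul e n x).symm.trans ((congrArg e hx).trans (e.apply_symm_apply y))⟩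
  isAddTorsion := hD.isAddTorsion.of_surjective (f := e.toAddMonoidHom) e.surjective
  infinite_socle p hp :=
    infinite_socle_of_injective (f := e.toAddMonoidHom) e.injective (hD.infinite_socle p hp)

theorem infinite (hD : IsGenericAddGroup D) : Infinite D :=
  Set.infinite_univ_iff.1 ((hD.infinite_socle 2 Nat.prime_two).mono (Set.subset_univ _))

end IsGenericAddGroup

theorem isDivisibleAddGroup_ratCircle : IsDivisibleAddGroup (AddCircle (1 : ℚ)) :=
  isDivisibleAddGroup_of_divisibleBy

theorem isAddTorsion_ratCircle : IsAddTorsion (AddCircle (1 : ℚ)) := by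
  intro x
  induction x using QuotientAddGroup.induction_on with
  | H q =>
    have horder := AddCircle.addOrderOf_coe_rat (p := (1 : ℚ)) (q := q)
    rw [Rat.cast_id, mul_one] at horder
    exact addOrderOf_pos_iff.1 (horder ▸ q.pos)

theorem exists_ratCircle_addOrderOf_eq {n : ℕ} (hn : 0 < n) :
    ∃ x : AddCircle (1 : ℚ), addOrderOf x = n :=
  ⟨_, AddCircle.addOrderOf_period_div hn⟩

instance countable_ratCircle : Countable (AddCircle (1 : ℚ)) :=
  (QuotientAddGroup.mk_surjective (s := AddSubgroup.zmultiples (1 : ℚ))).countable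

instance countable_directSum {ι : Type*} {M : ι → Type*} [Countable ι]
    [∀ i, AddCommMonoid (M i)] [∀ i, Countable (M i)] : Countable (⨁ i, M i) :=
  inferInstanceAs (Countable (Π₀ i, M i))

theorem isGenericAddGroup_pruferSum : IsGenericAddGroup PruferSum where
  isDivisible := .directSum fun p => .directSum fun _ =>
    isDivisibleAddGroup_ratCircle.primaryComponent p.2
  isAddTorsion := isAddTorsion_directSum fun _ => isAddTorsion_directSum fun _ =>
    isAddTorsion_ratCircle.addSubgroup _
  infinite_socle p hp := by
    classical
    obtain ⟨x, hx⟩ := exists_ratCircle_addOrderOf_eq hp.pos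
    have hpx : p • x = 0 := addOrderOf_dvd_iff_nsmul_eq_zero.1 hx.dvd
    let y : PruferGroup ⟨p, hp⟩ := ⟨x, 1, by rw [pow_one, hpx]⟩
    have hy : y ≠ 0 := fun h => hp.one_lt.ne
      (by rw [← hx, show x = 0 from congrArg Subtype.val h, addOrderOf_zero])
    exact infinite_socle_of_injective
      (DirectSum.of_injective (β := fun p : Nat.Primes => ⨁ _ : ℕ+, PruferGroup p) ⟨p, hp⟩)
      (infinite_socle_directSum hy (Subtype.ext hpx))

/-- A countable sum of copies of `ℚ / ℤ`: an isomorphic copy of `PruferSum` into which the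
characters of an abelian group map directly. -/
abbrev RatCircleSum : Type := ⨁ _ : ℕ, AddCircle (1 : ℚ)

theorem isGenericAddGroup_ratCircleSum : IsGenericAddGroup RatCircleSum where
  isDivisible := .directSum fun _ => isDivisibleAddGroup_ratCircle
  isAddTorsion := isAddTorsion_directSum fun _ => isAddTorsion_ratCircle
  infinite_socle p hp := by
    obtain ⟨x, hx⟩ := exists_ratCircle_addOrderOf_eq hp.pos
    exact infinite_socle_directSum
      (mt AddMonoid.addOrderOf_eq_one_iff.2 (hx ▸ hp.ne_one))
      (addOrderOf_dvd_iff_nsmul_eq_zero.1 hx.dvd)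

theorem exists_hom_ratCircleSum_injOn {A : Type*} [AddCommGroup A] {s : Set A} (hs : s.Finite) :
    ∃ f : A →+ RatCircleSum, s.InjOn f := by
  classical
  have exists_character (a : A) : ∃ c : A →+ AddCircle (1 : ℚ), a ≠ 0 → c a ≠ 0 := by
    obtain rfl | ha := eq_or_ne a 0
    · exact ⟨0, fun h => absurd rfl h⟩
    · obtain ⟨c, hc⟩ := CharacterModule.exists_character_apply_ne_zero_of_ne_zero ha
      exact ⟨c, fun _ => hc⟩
  choose c hc using exists_character
  obtain ⟨n, r, hr⟩ := (hs.sub hs).fin_embedding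
  let f : A →+ RatCircleSum := ∑ j : Fin n, (DirectSum.of _ (j : ℕ)).comp (c (r j))
  have hf (a : A) (j : Fin n) : f a (j : ℕ) = c (r j) a := by
    simp [f, DirectSum.sum_apply, DirectSum.of_apply, Fin.val_inj]
  refine ⟨f, fun a ha b hb hab => ?_⟩
  by_contra hne
  obtain ⟨j, hj⟩ : a - b ∈ Set.range r := hr ▸ Set.sub_mem_sub ha hb
  refine hc (a - b) (sub_ne_zero.2 hne) ?_
  rw [← hj, ← hf, hj, map_sub, hab, sub_self, DirectSum.zero_apply]

namespace IsGenericAddGroup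

variable {D : Type*} [AddCommGroup D]

theorem exists_hom_injOn [Countable D] (hD : IsGenericAddGroup D) {A : Type*} [AddCommGroup A]
    {s : Set A} (hs : s.Finite) : ∃ f : A →+ D, s.InjOn f := by
  obtain ⟨e⟩ := isGenericAddGroup_ratCircleSum.nonempty_addEquiv hD
  obtain ⟨f, hf⟩ := exists_hom_ratCircleSum_injOn hs
  exact ⟨e.toAddMonoidHom.comp f, e.injective.comp_injOn hf⟩

end IsGenericAddGroup

theorem infinite_socle_of_finite_universal {G : Type*} [Group G]
    (hG : ∀ (H : Type) [CommGroup H] [Finite H], ∃ f : H →* G, Function.Injective f) {p : ℕ}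
    (hp : p.Prime) : {x : G | x ^ p = 1}.Infinite := by
  intro hfin
  have : Fact p.Prime := ⟨hp⟩
  have : Finite {x : G | x ^ p = 1} := hfin
  obtain ⟨k, hk⟩ : ∃ k, Nat.card {x : G | x ^ p = 1} = k := ⟨_, rfl⟩
  obtain ⟨f, hf⟩ := hG (Multiplicative (Fin k → ZMod p))
  have hpow (x : Multiplicative (Fin k → ZMod p)) : f x ^ p = 1 := by
    have hx : x ^ p = 1 := Multiplicative.toAdd.injective (funext fun i => by simp)
    rw [← map_pow, hx, map_one]
  have hcard : Nat.card (Multiplicative (Fin k → ZMod p)) = p ^ k := by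
    simp [Nat.card_eq_fintype_card]
  have hle : p ^ k ≤ k := by
    rw [← hcard]
    nth_rw 2 [← hk]
    exact Nat.card_le_card_of_injective
      (fun x => (⟨f x, hpow x⟩ : {x : G | x ^ p = 1})) fun x y h => hf (congrArg Subtype.val h)
  exact (Nat.lt_pow_self hp.one_lt).not_ge hle

end GenericGroup

section Tables

instance instCountableAdditive {α : Type*} [Countable α] : Countable (Additive α) :=
  Additive.toMul.injective.countable

instance instCountableMultiplicative {α : Type*} [Countable α] : Countable (Multiplicative α) :=
  Multiplicative.toAdd.injective.countable

namespace AbelianTable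

noncomputable instance instCommGroupCarrier (G : AbelianTable) : CommGroup G.Carrier :=
  { G.1.instGroupCarrier with mul_comm := G.2 }

instance instCountableCarrier (G : AbelianTable) : Countable G.Carrier :=
  inferInstanceAs (Countable ℕ+)

/-- The table of an abelian group transported to `ℕ+` along an enumeration starting at `1`. -/
def ofEquiv {T : Type*} [CommGroup T] (e : ℕ+ ≃ T) (he : e 1 = 1) : AbelianTable :=
  ⟨⟨fun x => e.symm (e x.1 * e x.2), fun a b c => by simp only [e.apply_symm_apply, mul_assoc],
    fun a => by simp only [he, one_mul, mul_one, e.symm_apply_apply, and_self],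
    fun a => ⟨e.symm (e a)⁻¹, by
      simp only [e.apply_symm_apply, inv_mul_cancel, mul_inv_cancel, ← he, e.symm_apply_apply,
        and_self]⟩⟩,
    fun a b => congrArg e.symm (mul_comm (e a) (e b))⟩

/-- An enumeration of a group, as an isomorphism from the group of the transported table. -/
def ofEquivMulEquiv {T : Type*} [CommGroup T] (e : ℕ+ ≃ T) (he : e 1 = 1) :
    (ofEquiv e he).Carrier ≃* T where
  toEquiv := e
  map_mul' a b := e.apply_symm_apply (e a * e b)

theorem ofEquiv_apply_eq {T : Type*} [CommGroup T] {e : ℕ+ ≃ T} (he : e 1 = 1) {G : AbelianTable}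
    {f : G.Carrier →* T} {x : ℕ+ × ℕ+} (h₁ : e x.1 = f x.1) (h₂ : e x.2 = f x.2)
    (h₃ : e (G.1.1 x) = f (G.1.1 x)) : (ofEquiv e he).1.1 x = G.1.1 x :=
  e.symm_apply_eq.2 ((congrArg₂ (· * ·) h₁ h₂).trans ((map_mul f _ _).symm.trans h₃.symm))

end AbelianTable

theorem isoClass_congr {H K : Type*} [Group H] [Group K] (e : H ≃* K) : isoClass H = isoClass K :=
  Set.ext fun _ => ⟨fun ⟨f⟩ => ⟨f.trans e⟩, fun ⟨f⟩ => ⟨f.trans e.symm⟩⟩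

theorem exists_equiv_eqOn {α β : Type*} [Countable α] [Infinite α] [Countable β] [Infinite β]
    {s : Set α} (hs : s.Finite) {f : α → β} (hf : s.InjOn f) : ∃ e : α ≃ β, s.EqOn e f := by
  have := hs.to_subtype
  let g : s ↪ β := ⟨s.domRestrict f, hf.injective⟩
  have : Infinite ↑sᶜ := hs.infinite_compl.to_subtype
  have : Infinite ↑(Set.range g)ᶜ := (Set.finite_range g).infinite_compl.to_subtype
  obtain ⟨e, he⟩ := Cardinal.extend_function g nonempty_equiv_of_countable
  exact ⟨e, fun x hx => he ⟨x, hx⟩⟩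

theorem nonempty_isoClass (H : Type*) [CommGroup H] [Countable H] [Infinite H] :
    (isoClass H).Nonempty := by
  obtain ⟨e, he⟩ := exists_equiv_eqOn (f := fun _ : ℕ+ => (1 : H)) (Set.finite_singleton 1)
    (Set.injOn_singleton _ _)
  exact ⟨.ofEquiv e (he rfl), ⟨AbelianTable.ofEquivMulEquiv e (he rfl)⟩⟩

/-- The tables of groups with infinite `p`-torsion for every prime `p`. Unlike
`finiteUniversalTables`, to which it is equivalent for divisible torsion groups, this set is visibly
a countable intersection of open sets. -/
def infiniteSocleTables : Set AbelianTable :=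
  {G | ∀ p : ℕ, p.Prime → {x : G.Carrier | x ^ p = 1}.Infinite}

theorem finiteUniversalTables_subset_infiniteSocleTables :
    finiteUniversalTables ⊆ infiniteSocleTables :=
  fun _ hG _ hp => infinite_socle_of_finite_universal hG hp

theorem isGenericAddGroup_additive_carrier_iff {G : AbelianTable} :
    IsGenericAddGroup (Additive G.Carrier) ↔
      G ∈ divisibleTables ∩ torsionTables ∩ infiniteSocleTables where
  mp h := ⟨⟨fun g k hk => h.isDivisible k hk.ne' (.ofMul g),
    fun g => (isOfFinAddOrder_ofMul_iff (x := g)).1 (h.isAddTorsion (.ofMul g))⟩, h.infinite_socle⟩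
  mpr h := ⟨fun k hk g => h.1.1 g.toMul k (Nat.pos_of_ne_zero hk),
    fun g => (isOfFinAddOrder_ofMul_iff (x := g.toMul)).2 (h.1.2 g.toMul), h.2⟩

theorem isoClass_eq_of_isGenericAddGroup {D : Type*} [AddCommGroup D] [Countable D]
    (hD : IsGenericAddGroup D) :
    isoClass (Multiplicative D) = divisibleTables ∩ torsionTables ∩ infiniteSocleTables := by
  ext G
  rw [← isGenericAddGroup_additive_carrier_iff]
  constructor
  · rintro ⟨e⟩
    exact hD.of_addEquiv (MulEquiv.toAdditiveLeft e).symm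
  · exact fun hG => (hG.nonempty_addEquiv hD).map MulEquiv.toAdditiveLeft.symm

theorem infiniteSocle_inter_eq_finiteUniversal_inter :
    divisibleTables ∩ torsionTables ∩ infiniteSocleTables =
      divisibleTables ∩ torsionTables ∩ finiteUniversalTables := by
  refine subset_antisymm (fun G hG => ⟨hG.1, fun H _ _ => ?_⟩)
    (Set.inter_subset_inter_right _ finiteUniversalTables_subset_infiniteSocleTables)
  obtain ⟨f, hf⟩ := (isGenericAddGroup_additive_carrier_iff.2 hG).exists_hom_injOn
    (Set.toFinite (Set.univ : Set (Additive H)))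
  exact ⟨AddMonoidHom.toMultiplicative f, Set.injOn_univ.1 hf⟩

end Tables

section Topology

open Topology

theorem exists_finset_forall_eq_imp_mem {X ι : Type*} {Y : ι → Type*} [TopologicalSpace X]
    [∀ i, TopologicalSpace (Y i)] {φ : X → ∀ i, Y i} (hφ : IsInducing φ) {U : Set X}
    (hU : IsOpen U) {x : X} (hx : x ∈ U) :
    ∃ I : Finset ι, ∀ y, (∀ i ∈ I, φ y i = φ x i) → y ∈ U := by
  obtain ⟨V, hV, rfl⟩ := hφ.isOpen_iff.1 hU
  obtain ⟨I, u, hu, hsub⟩ := isOpen_pi_iff.1 hV _ hx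
  exact ⟨I, fun y hy => hsub fun i hi => (hy i hi).symm ▸ (hu i hi).2⟩

theorem isInducing_abelianTable : IsInducing fun G : AbelianTable => G.1.1 :=
  IsInducing.subtypeVal.comp IsInducing.subtypeVal

theorem dense_isoClass {H : Type*} [CommGroup H] [Countable H] [Infinite H]
    (hH : ∀ (G : AbelianTable) (s : Set G.Carrier), s.Finite → ∃ f : G.Carrier →* H, s.InjOn f) :
    Dense (isoClass H) := by
  rw [dense_iff_inter_open]
  rintro U hU ⟨G, hG⟩
  obtain ⟨I, hI⟩ := exists_finset_forall_eq_imp_mem isInducing_abelianTable hU hG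
  let s : Set ℕ+ := {1} ∪ ⋃ x ∈ I, {x.1, x.2, G.1.1 x}
  have hs : s.Finite := (Set.finite_singleton _).union
    (I.finite_toSet.biUnion fun x _ => Set.toFinite _)
  have hmem {x : ℕ+ × ℕ+} (hx : x ∈ I) : {x.1, x.2, G.1.1 x} ⊆ s :=
    (Set.subset_biUnion_of_mem (u := fun x : ℕ+ × ℕ+ => ({x.1, x.2, G.1.1 x} : Set ℕ+)) hx).trans
      Set.subset_union_right
  obtain ⟨f, hf⟩ := hH G s hs
  obtain ⟨e, he⟩ := exists_equiv_eqOn (α := ℕ+) hs hf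
  have he₁ : e 1 = 1 := (he (Or.inl rfl)).trans (map_one f)
  refine ⟨.ofEquiv e he₁, hI _ fun x hx => AbelianTable.ofEquiv_apply_eq he₁ (f := f) ?_ ?_ ?_,
    ⟨AbelianTable.ofEquivMulEquiv e he₁⟩⟩
  · exact he (hmem hx (by simp))
  · exact he (hmem hx (by simp))
  · exact he (hmem hx (by simp))

theorem IsGenericAddGroup.dense_isoClass {D : Type*} [AddCommGroup D] [Countable D]
    (hD : IsGenericAddGroup D) : Dense (isoClass (Multiplicative D)) :=
  have := hD.infinite
  _root_.dense_isoClass fun G _ hs =>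
    let ⟨f, hf⟩ := hD.exists_hom_injOn (A := Additive G.Carrier) hs
    ⟨AddMonoidHom.toMultiplicativeRight f, hf⟩

theorem continuous_table_apply (x : ℕ+ × ℕ+) : Continuous fun G : AbelianTable => G.1.1 x :=
  (continuous_apply x).comp isInducing_abelianTable.continuous

/-- The element of the group with table `G` named by a positive integer. -/
def AbelianTable.element (G : AbelianTable) (n : ℕ+) : G.Carrier := n

theorem isOpen_setOf_element_pow_eq (m g : ℕ+) (k : ℕ) :
    IsOpen {G : AbelianTable | G.element m ^ k = G.element g} := by
  induction k generalizing g with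
  | zero => exact isOpen_const (p := (1 : ℕ+) = g)
  | succ k ih =>
    have hsucc : {G : AbelianTable | G.element m ^ (k + 1) = G.element g} =
        ⋃ a : ℕ+, {G | G.element m ^ k = G.element a} ∩ {G | G.1.1 (a, m) = g} := by
      ext G
      simp only [Set.mem_iUnion]
      exact ⟨fun h => ⟨G.element m ^ k, rfl, (pow_succ (G.element m) k).symm.trans h⟩,
        fun ⟨a, ha, hg⟩ => (pow_succ (G.element m) k).trans ((congrArg (· * _) ha).trans hg)⟩
    rw [hsucc]
    exact isOpen_iUnion fun a =>
      (ih a).inter ((isOpen_discrete {g}).preimage (continuous_table_apply (a, m)))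

theorem isGδ_divisibleTables : IsGδ divisibleTables := by
  have hdiv : divisibleTables =
      ⋂ (g : ℕ+) (k : ℕ) (_ : 0 < k), ⋃ m, {G | G.element m ^ k = G.element g} := by
    ext G
    simp only [Set.mem_iInter, Set.mem_iUnion]
    rfl
  rw [hdiv]
  exact .iInter fun g => .iInter fun k => .iInter fun _ =>
    (isOpen_iUnion fun m => isOpen_setOf_element_pow_eq m g k).isGδ

theorem isGδ_torsionTables : IsGδ torsionTables := by
  have htor : torsionTables =
      ⋂ m : ℕ+, ⋃ (k : ℕ) (_ : 0 < k), {G | G.element m ^ k = G.element 1} := by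
    ext G
    simp only [Set.mem_iInter, Set.mem_iUnion, exists_prop]
    exact forall_congr' fun m => isOfFinOrder_iff_pow_eq_one (x := G.element m)
  rw [htor]
  exact .iInter fun m => (isOpen_iUnion fun k => isOpen_iUnion fun _ =>
    isOpen_setOf_element_pow_eq m 1 k).isGδ

theorem isGδ_infiniteSocleTables : IsGδ infiniteSocleTables := by
  have hsocle : infiniteSocleTables =
      ⋂ (p : ℕ) (_ : p.Prime) (n : ℕ+), ⋃ (m : ℕ+) (_ : n < m),
        {G | G.element m ^ p = G.element 1} := by
    ext G
    simp only [Set.mem_iInter, Set.mem_iUnion, exists_prop]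
    exact forall₂_congr fun p _ => (Set.infinite_iff_exists_gt (α := ℕ+)).trans
      (forall_congr' fun n => exists_congr fun m => and_comm)
  rw [hsocle]
  exact .iInter fun p => .iInter fun _ => .iInter fun n =>
    (isOpen_iUnion fun m => isOpen_iUnion fun _ => isOpen_setOf_element_pow_eq m 1 p).isGδ

theorem IsGenericAddGroup.isGδ_isoClass {D : Type*} [AddCommGroup D] [Countable D]
    (hD : IsGenericAddGroup D) : IsGδ (isoClass (Multiplicative D)) := by
  rw [isoClass_eq_of_isGenericAddGroup hD]
  exact (isGδ_divisibleTables.inter isGδ_torsionTables).inter isGδ_infiniteSocleTables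

end Topology

section Polish

theorem polishSpace_of_isGδ {X : Type*} [TopologicalSpace X] [PolishSpace X] {s : Set X}
    (hs : IsGδ s) : PolishSpace s := by
  obtain ⟨U, hU, rfl⟩ := hs.eq_iInter_nat
  have (n : ℕ) : PolishSpace (U n) := (hU n).polishSpace
  let diag : ↥(⋂ n, U n) → ∀ n, U n := fun x n => ⟨x, Set.mem_iInter.1 x.2 n⟩
  have hdiag : Continuous diag :=
    continuous_pi fun n => continuous_subtype_val.subtype_mk _
  have hrange : Set.range diag = {f | ∀ n m, (f n : X) = f m} := by
    ext f
    refine ⟨fun ⟨x, hx⟩ n _ => hx ▸ rfl, fun hf => ?_⟩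
    exact ⟨⟨f 0, Set.mem_iInter.2 fun n => hf 0 n ▸ (f n).2⟩,
      funext fun n => Subtype.ext (hf 0 n)⟩
  have hclosed : IsClosed (Set.range diag) := by
    simp only [hrange, Set.ofPred_forall]
    exact isClosed_iInter fun n => isClosed_iInter fun m => isClosed_eq
      (continuous_subtype_val.comp (continuous_apply n))
      (continuous_subtype_val.comp (continuous_apply m))
  exact Topology.IsClosedEmbedding.polishSpace (f := diag)
    ⟨.of_comp hdiag (continuous_subtype_val.comp (continuous_apply 0)) .subtypeVal, hclosed⟩

theorem continuous_eval_of_discrete {α β : Type*} [TopologicalSpace α] [DiscreteTopology α]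
    [TopologicalSpace β] : Continuous fun p : (α → β) × α => p.1 p.2 :=
  continuous_prod_of_discrete_right.2 fun a => continuous_apply a

theorem isClosed_setOf_associative {α : Type*} [TopologicalSpace α] [DiscreteTopology α] :
    IsClosed {A : α × α → α | ∀ a b c, A (A (a, b), c) = A (a, A (b, c))} := by
  simp only [Set.ofPred_forall]
  refine isClosed_iInter fun a => isClosed_iInter fun b => isClosed_iInter fun c =>
    isClosed_eq (continuous_eval_of_discrete.comp (continuous_id.prodMk ?_))
      (continuous_eval_of_discrete.comp (continuous_id.prodMk ?_))
  · exact (continuous_apply (a, b)).prodMk continuous_const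
  · exact continuous_const.prodMk (continuous_apply (b, c))

theorem isGδ_groupTables : IsGδ groupTables := by
  have hone : IsClosed {A : ℕ+ × ℕ+ → ℕ+ | ∀ a, A (1, a) = a ∧ A (a, 1) = a} := by
    simp only [Set.ofPred_forall, Set.ofPred_and]
    exact isClosed_iInter fun a => (isClosed_eq (continuous_apply _) continuous_const).inter
      (isClosed_eq (continuous_apply _) continuous_const)
  have hinv : IsGδ {A : ℕ+ × ℕ+ → ℕ+ | ∀ a, ∃ b, A (b, a) = 1 ∧ A (a, b) = 1} := by
    simp only [Set.ofPred_forall, Set.ofPred_exists, Set.ofPred_and]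
    exact .iInter fun a => (isOpen_iUnion fun b =>
      ((isOpen_discrete {1}).preimage (continuous_apply (b, a))).inter
        ((isOpen_discrete {1}).preimage (continuous_apply (a, b)))).isGδ
  exact isClosed_setOf_associative.isGδ.inter (hone.isGδ.inter hinv)

theorem isClosed_abelianTables : IsClosed abelianTables := by
  have habelian : abelianTables = {G | ∀ a b, G.1 (a, b) = G.1 (b, a)} := rfl
  simp only [habelian, Set.ofPred_forall]
  exact isClosed_iInter fun a => isClosed_iInter fun b => isClosed_eq
    ((continuous_apply (a, b)).comp continuous_subtype_val)
    ((continuous_apply (b, a)).comp continuous_subtype_val)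

theorem polishSpace_abelianTable : PolishSpace AbelianTable :=
  have := polishSpace_of_isGδ isGδ_groupTables
  isClosed_abelianTables.polishSpace

end Polish

theorem corollary3p15 :
    PolishSpace AbelianTable ∧
    isoClass (Multiplicative PruferSum) =
      divisibleTables ∩ torsionTables ∩ finiteUniversalTables ∧
    IsGδ (isoClass (Multiplicative PruferSum)) ∧
    Dense (isoClass (Multiplicative PruferSum)) ∧
    isoClass (Multiplicative PruferSum) ∈ residual AbelianTable ∧
    ∃ A : AbelianTable, Nonempty (A.Carrier ≃* Multiplicative PruferSum) ∧
      isoClass A.Carrier ∈ residual AbelianTable := by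
  have hP := isGenericAddGroup_pruferSum
  have hres := residual_of_dense_Gδ hP.isGδ_isoClass hP.dense_isoClass
  have := hP.infinite
  obtain ⟨A, ⟨e⟩⟩ := nonempty_isoClass (Multiplicative PruferSum)
  exact ⟨polishSpace_abelianTable,
    (isoClass_eq_of_isGenericAddGroup hP).trans infiniteSocle_inter_eq_finiteUniversal_inter,
    hP.isGδ_isoClass, hP.dense_isoClass, hres, A, ⟨e⟩, isoClass_congr e ▸ hres⟩
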